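/- **Setting.** A dimer is a finite connected bipartite graph (nodes black or white, multiple edges allowed) embedded in the oriented torus $T^2=\mathbb R^2/\mathbb Z^2$ so that all $F$ faces are discs; $E$ denotes its set of edges. A *zigzag path* is a closed path in the graph that alternately takes the next edge counterclockwise around a white node and the next edge clockwise around a black node. Each edge $e$ is a crossing of two zigzag strands, each drawn through the midpoint of $e$, counterclockwise as seen from white nodes and clockwise as seen from black nodes. The edge $e$ is a *positively oriented intersection of $Z_r$ with $Z_s$* if these are the two strands and the tangent of $Z_s$ is counterclockwise from the tangent of $Z_r$, and a *negatively oriented* one if it is clockwise. Let $\mathbf w_r\in\mathbb Z^2$ be the winding number of $Z_r$ and $(a,b)\wedge(c,d)=ad-bc$. The dimer is *properly ordered* if no zigzag path has winding zero, no two zigzag strands with the same winding direction cross, and at every node the circular order of the zigzag paths around the node is the circular order of the directions of their windings. A *perfect matching* is a set of edges such that each node is an endpoint of exactly one of them. Let $\gamma_w,\gamma_z$ be loops of winding $(1,0)$ and $(0,1)$. The Kasteleyn matrix has a row for each white node and a column for each black node, and its entry is the sum of $c_e w^{a_e}z^{b_e}$ over the edges $e$ joining the two nodes, where the $c_e$ are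 independent (generic) coefficients, $a_e$ is the number of times $\gamma_w$ crosses $e$ with the white endpoint on its left minus the number of times it crosses $e$ with the white endpoint on its right, and $b_e$ is defined likewise from $\gamma_z$. The *toric diagram* is the Newton polygon of its determinant, and a perfect matching $M$ corresponds to the point $\sum_{e\in M}(a_e,b_e)$. **Basis matchings.** Let $Z_0,\dots,Z_{n-1}$ be all the zigzag paths, each listed once, and $M_0,\dots,M_{n-1}$ perfect matchings whose points are the boundary lattice points of the toric diagram, each occurring once, in counterclockwise order, such that for each $i$ (indices modulo $n$) the set of edges in exactly one of $M_i$, $M_{i+1}$ is the set of edges of $Z_i$. So $Z_i$ is associated with the boundary segment from the point of $M_i$ to the point of $M_{i+1}$. For $r\ne s$ let $cc(r,s)=\{r+1,r+2,\dots,s\}$ (modulo $n$), the indices of the boundary lattice points on the counterclockwise stretch of the boundary from the segment of $Z_r$ to the segment of $Z_s$. **Proposition.** In a properly ordered dimer, for every such choice of the $Z_i$ and $M_i$ and all $r\neq s$: 1. every positively oriented intersection of $Z_r$ with $Z_s$ lies in $M_i$ if and only if $i\in cc(r,s)$; 2. every negatively oriented intersection of $Z_r$ with $Z_s$ lies in $M_i$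 if and only if $i\in cc(s,r)$. (No zigzag path intersects itself.) Consequently, let $\delta_M$ be the function on edges that is $2$ on $M$ and $0$ elsewhere, let $\lambda_0,\dots,\lambda_{n-1}$ be real numbers, and let $R=\sum_i\lambda_i\delta_{M_i}$ satisfy $\sum_{e\ni v}R(e)=2$ at every node $v$. Then for every natural number $N$ the anomaly $$a=\frac{9N^2}{32}\Big[F+\sum_{e\in E}(R(e)-1)^3\Big]$$ is given by the Butti–Zaffaroni formula $$a=\frac{9N^2}{32}\Big[F+\sum_{r<s}(\mathbf w_r\wedge\mathbf w_s)\Big(2\Big(\sum_{i\in cc(r,s)}\lambda_i\Big)-1\Big)^3\Big].$$ -/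

import Mathlib

open Equiv

/-- The wedge `(a, b) ∧ (c, d) = a d - b c` of two plane vectors. -/
def wedge {R : Type*} [CommRing R] (u v : R × R) : R := u.1 * v.2 - u.2 * v.1

/-- The strict circular order on directions of plane vectors: `u`, `v`, `w` are nonzero, have three
different directions, and a ray turning counterclockwise from `u` meets the direction of `v`
strictly before that of `w`.  The three counterclockwise angles from `u` to `v`, `v` to `w`,
`w` to `u` add up to one turn in this case (so that at most one of them is at least a half turn) and
to two turns (so that at most one is less than a half turn) if the order is the opposite one; if two
of the directions agree or a vector vanishes then at most one of the wedges is positive. -/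
def Counterclockwise (u v w : ℤ × ℤ) : Prop :=
  (0 < wedge u v ∧ 0 < wedge v w) ∨ (0 < wedge v w ∧ 0 < wedge w u) ∨
    (0 < wedge w u ∧ 0 < wedge u v)

/-- The cycles of a permutation, fixed points included. -/
abbrev PermCycles {E : Type*} (σ : Perm E) : Type _ := Quotient (Perm.SameCycle.setoid σ)

/-- A bipartite graph drawn on a closed oriented surface, encoded by its rotation system: the set of
edges is `E`, and `white e` (`black e`) is the edge that follows `e` counterclockwise around the
white (black) endpoint of `e`. Several edges may join the same two nodes. -/
structure BipartiteMap (E : Type*) where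
  white : Perm E
  black : Perm E

namespace BipartiteMap

variable {E : Type*} (D : BipartiteMap E)

/-- White nodes. -/
abbrev White : Type _ := PermCycles D.white

/-- Black nodes. -/
abbrev Black : Type _ := PermCycles D.black

/-- The white endpoint of an edge. -/
def whiteEnd (e : E) : D.White := Quotient.mk _ e

/-- The black endpoint of an edge. -/
def blackEnd (e : E) : D.Black := Quotient.mk _ e

/-- Walk around a face counterclockwise, with the face on the left: go along `e` from its black to
its white endpoint, take there the next edge clockwise, `white⁻¹ e`, go along it to its black
endpoint, and take there the next edge clockwise. -/
def facePerm : Perm E := D.black⁻¹ * D.white⁻¹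

/-- Faces; a face with `2 n` sides is a cycle of length `n` of `facePerm`. -/
abbrev Face : Type _ := PermCycles D.facePerm

/-- Follow a zigzag path: it arrives at the edge `e` from the side of the black endpoint of `e`, goes
counterclockwise around the white endpoint of `e` to the edge `white e`, and from there
clockwise around the black endpoint of `white e` to the edge `black⁻¹ (white e)`. -/
def zigzagPerm : Perm E := D.black⁻¹ * D.white

/-- Zigzag paths, oriented counterclockwise around white and clockwise around black nodes. -/
abbrev Zigzag : Type _ := PermCycles D.zigzagPerm

/-- The zigzag path that leaves the edge `e` towards its white endpoint: it runs
from `black e` through `e` to `white e`, that is, through the sector between `e` and the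
counterclockwise next edge, both at the white and at the black endpoint of `e`. -/
def zigzagToWhite (e : E) : D.Zigzag := Quotient.mk _ e

/-- The zigzag path that leaves the edge `e` towards its black endpoint: it runs
from `white⁻¹ e` through `e` to `black⁻¹ e`. -/
def zigzagToBlack (e : E) : D.Zigzag := Quotient.mk _ (D.white⁻¹ e)

/-- The edge `e` belongs to the zigzag path `z`. -/
def MemZigzag (e : E) (z : D.Zigzag) : Prop := D.zigzagToWhite e = z ∨ D.zigzagToBlack e = z

/-- The edge `e` is a positively oriented intersection of `r` with `s`: the tangent of `s` is
counterclockwise from that of `r`.  (With the white endpoint of `e` on the left and the black one on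
the right, both strands cross `e` upwards, one towards the upper right, leaving towards the black
endpoint, and the other one towards the upper left, leaving towards the white endpoint.) -/
def PosIntersection (e : E) (r s : D.Zigzag) : Prop :=
  r = D.zigzagToBlack e ∧ s = D.zigzagToWhite e

/-- The edge `e` is a negatively oriented intersection of `r` with `s`: the tangent of `s` is
clockwise from that of `r`. -/
def NegIntersection (e : E) (r s : D.Zigzag) : Prop :=
  r = D.zigzagToWhite e ∧ s = D.zigzagToBlack e

/-- A perfect matching: every node is an endpoint of exactly one edge of `M`. -/
def IsPerfectMatching (M : Finset E) : Prop :=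
  (∀ v : D.White, ∃! e, e ∈ M ∧ D.whiteEnd e = v) ∧
    ∀ v : D.Black, ∃! e, e ∈ M ∧ D.blackEnd e = v

/-- The steps of the boundary walk of the face to the left of `e` (travelled from black to white),
starting with `e`, if `d` gives the step from the white to the black endpoint for each edge. -/
noncomputable def faceSteps (d : E → ℤ × ℤ) (e : E) : List (ℤ × ℤ) :=
  (List.range (Function.minimalPeriod D.facePerm e)).flatMap fun k =>
    [-d ((D.facePerm ^ k) e), d (D.white⁻¹ ((D.facePerm ^ k) e))]

end BipartiteMap

/-- Twice the signed area enclosed by a closed polygon in the plane with the given sequence of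
steps, `∑ dᵢ ∧ dⱼ` over `i < j` (positive if it is traversed counterclockwise). -/
def twiceArea : List (ℤ × ℤ) → ℤ
  | [] => 0
  | d :: l => wedge d l.sum + twiceArea l

/-- A dimer model on the oriented torus `ℝ² / ℤ²`, all of whose faces are discs.

`step e` says how the edge `e`, from its white to its black endpoint, winds around the torus: if
the torus is cut along a vertical and a horizontal loop that avoid the nodes, the two components of
`step e` are the signed numbers of times that `e` crosses the vertical loop to the
right and the horizontal loop upwards. So lifts of the nodes to the plane may be labelled by
`ℤ²`, and the lift of `e` that starts at the lift `p` of its white endpoint ends at the lift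
`p + step e` of its black endpoint.

The rotation system describes a closed connected oriented surface (`connected`) of Euler
characteristic zero (`euler`). Face boundaries lift to closed polygons in the plane (`closed`), so
that `step` describes a map from the surface to `ℝ² / ℤ²` up to homotopy. Its degree, the
total signed area of the images of the faces in the plane, is one (`degree`), which
says that it is homotopic to an orientation preserving homeomorphism. -/
structure TorusDimer (E : Type*) [Fintype E] extends BipartiteMap E where
  step : E → ℤ × ℤ
  connected : MulAction.IsPretransitive (Subgroup.closure {white, black} : Subgroup (Perm E)) E
  euler : Nat.card toBipartiteMap.White + Nat.card toBipartiteMap.Black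
    + Nat.card toBipartiteMap.Face = Fintype.card E
  closed : ∀ e, (toBipartiteMap.faceSteps step e).sum = 0
  degree : ∑ᶠ f : toBipartiteMap.Face, twiceArea (toBipartiteMap.faceSteps step f.out) = 2

namespace TorusDimer

variable {E : Type*} [Fintype E] (D : TorusDimer E)

open Classical in
/-- The winding number of a zigzag path in `ℤ²`.  As a path in the graph, the zigzag path
alternately goes along an edge `e` from black to white, and along `white e` from white to black. -/
noncomputable def winding (z : D.Zigzag) : ℤ × ℤ :=
  ∑ e : E with D.zigzagToWhite e = z, (D.step (D.white e) - D.step e)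

/-- The zigzag paths in the successive sectors around the node at which `σ` (one of `D.white` and
`D.black`) turns an edge `e` counterclockwise are those leaving the edges `e`, `σ e`, `σ² e`, …
towards white. Their windings have to be in strict counterclockwise order. -/
def OrderedAt (σ : Perm E) (e : E) : Prop :=
  ∀ j k : ℕ, 0 < j → j < k → k < Function.minimalPeriod σ e →
    Counterclockwise (D.winding (D.zigzagToWhite e)) (D.winding (D.zigzagToWhite ((σ ^ j) e)))
      (D.winding (D.zigzagToWhite ((σ ^ k) e)))

/-- A properly ordered dimer: the zigzag paths around each node are in the same circular order as
the directions of their windings, where no winding is zero and no two zigzag paths with the same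
winding direction intersect (in particular no zigzag path intersects itself). -/
structure ProperlyOrdered : Prop where
  winding_ne_zero : ∀ z : D.Zigzag, D.winding z ≠ 0
  not_sameRay : ∀ e, ¬ SameRay ℤ (D.winding (D.zigzagToBlack e)) (D.winding (D.zigzagToWhite e))
  white_ordered : ∀ e, D.OrderedAt D.white e
  black_ordered : ∀ e, D.OrderedAt D.black e

/-- The exponent of `(w, z)` in the Kasteleyn weight of an edge, with `γ_w` the horizontal loop
oriented to the right and `γ_z` the vertical loop oriented upwards.  The exponent of `w` is the
number of times that `γ_w` crosses the edge with the white endpoint on its left minus the number of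
times that it does so with the white endpoint on its right; in the first case the edge, from
white to black, goes downwards. Similarly for the exponent of `z`. -/
def exponent (e : E) : ℤ × ℤ := (-(D.step e).2, (D.step e).1)

open Classical in
/-- The Kasteleyn matrix, with independent indeterminate coefficients `c_e` for the edges `e`:
the entry at a white and a black node is the sum of `c_e w^a z^b` over the edges `e` joining them. -/
noncomputable def kasteleyn :
    Matrix D.White D.Black (AddMonoidAlgebra (MvPolynomial E ℂ) (ℤ × ℤ)) :=
  fun v v' => ∑ e : E with D.whiteEnd e = v ∧ D.blackEnd e = v',
    AddMonoidAlgebra.single (D.exponent e) (MvPolynomial.X e)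

open Classical in
/-- The exponents of the monomials that occur in the determinant of the Kasteleyn matrix. To form the
determinant, white and black nodes are identified by a bijection, which affects only its sign. -/
noncomputable def determinantExponents : Set (ℤ × ℤ) :=
  {p | ∃ β : D.White ≃ D.Black, p ∈ ((D.kasteleyn.submatrix id β).det).coeff.support}

/-- The toric diagram: the Newton polygon of the determinant of the Kasteleyn matrix. -/
noncomputable def toricDiagram : Set (ℝ × ℝ) :=
  convexHull ℝ ((fun p : ℤ × ℤ => ((p.1 : ℝ), (p.2 : ℝ))) '' D.determinantExponents)

/-- The point of the toric diagram that corresponds to a perfect matching. -/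
def point (M : Finset E) : ℤ × ℤ := ∑ e ∈ M, D.exponent e

/-- The lattice points `p` and `q` are consecutive on the boundary of the toric diagram, `q` being
the next one counterclockwise: both belong to the diagram, the diagram lies to the left
of the line from `p` to `q`, and `p ≠ q` with no lattice point strictly between them. -/
def NextBoundaryPoint (p q : ℤ × ℤ) : Prop :=
  ((p.1 : ℝ), (p.2 : ℝ)) ∈ D.toricDiagram ∧ ((q.1 : ℝ), (q.2 : ℝ)) ∈ D.toricDiagram ∧
    (∀ x ∈ D.toricDiagram,
      0 ≤ wedge ((q.1 : ℝ) - p.1, (q.2 : ℝ) - p.2) (x.1 - p.1, x.2 - p.2)) ∧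
    Int.gcd (q.1 - p.1) (q.2 - p.2) = 1

/-- A basis of boundary perfect matchings `M₀, …, Mₙ₋₁` and zigzag paths `Z₀, …, Zₙ₋₁`, one
perfect matching for each boundary lattice point and one zigzag path for each boundary segment of
the toric diagram, both in counterclockwise order: the segment `i` goes from the point of
`Mᵢ` to the point of `Mᵢ₊₁` (indices modulo `n`), and the difference of `Mᵢ` and `Mᵢ₊₁`, the set of
edges that belong to exactly one of them, is `Zᵢ`. Since the points are distinct and each one is
followed by the next boundary lattice point, the boundary is traversed exactly once. -/
structure IsBoundaryBasis {n : ℕ} (Z : Fin n ≃ D.Zigzag) (M : Fin n → Finset E) : Prop where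
  perfect : ∀ i, D.IsPerfectMatching (M i)
  injective : Function.Injective fun i => D.point (M i)
  next : ∀ i, D.NextBoundaryPoint (D.point (M i)) (D.point (M (finRotate n i)))
  diff : ∀ i e, Xor (e ∈ M i) (e ∈ M (finRotate n i)) ↔ D.MemZigzag e (Z i)

open Classical in
/-- The condition `∑_{e ∈ v} R(e) = 2` for every node `v`. -/
def NodeCondition (R : E → ℝ) : Prop :=
  (∀ v : D.White, ∑ e : E with D.whiteEnd e = v, R e = 2) ∧
    ∀ v : D.Black, ∑ e : E with D.blackEnd e = v, R e = 2

/-- The cubic 't Hooft anomaly `a = (9 N² / 32) (F + ∑ₑ (R(e) - 1)³)`. -/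
noncomputable def anomaly (N : ℕ) (R : E → ℝ) : ℝ :=
  9 * (N : ℝ) ^ 2 / 32 * ((Nat.card D.Face : ℝ) + ∑ e, (R e - 1) ^ 3)

end TorusDimer

/-- The function `δ_M` on edges: `2` on the edges of `M` and `0` on the others. -/
def matchingDelta {E : Type*} [DecidableEq E] (M : Finset E) (e : E) : ℝ := if e ∈ M then 2 else 0

/-- The counterclockwise boundary segment `cc(r, s)`, as a set of boundary points: those met when
going counterclockwise from the boundary segment `r` (which joins the points `r` and `r + 1`) to the
boundary segment `s`, that is, the points `r + 1, r + 2, …, s` modulo `n`. -/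
def cc {n : ℕ} (r s : Fin n) : Finset (Fin n) :=
  Finset.univ.filter fun i => (r < s ∧ r < i ∧ i ≤ s) ∨ (s < r ∧ (r < i ∨ i ≤ s))

/-! The heart is `mem_of_zigzagToWhite`: the edges that `Z i` leaves towards white lie in `M i`, so
those that it leaves towards black lie in the next matching. A positive crossing of `Z r` with `Z s`
therefore joins the matchings between `M r` and its successor and drops out between `M s` and its
successor. It lies on no third zigzag path, so nothing changes elsewhere, and `iff_mem_cc`
concludes.

For the heart, `Z i` alternates between `M i` and its successor, which fixes the difference of their
step sums up to sign: it is plus or minus the winding of `Z i`, with plus in the desired case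
(`sum_step_sub`). On `Z i` the matching `M i` has half of the edges, the most that any matching can
have. That number is, up to a constant, an affine function of the step sum of the matching
(`sum_zigzagCochain_sub`), which bounds all `M j` on one side. Convexity of the toric diagram bounds
them on the side given by the sign. With the wrong sign both bounds force all the points onto one
line, hence all windings to be parallel; Euler characteristic zero excludes this in a properly
ordered dimer (`exists_wedge_ne_zero`).

The affine function comes from Poincaré duality on the torus (`exists_zigzagCochain_eq`), proved by
rational linear algebra: connectedness and the Euler characteristic give the dimension of the space
of closed cochains, and degree one normalises the cup product. Duality also gives `wedge_winding`,
which turns the sum over edges in the anomaly into the sum over pairs of zigzag paths. -/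

/-! ### Sums and primitives along the cycles of a permutation -/

/-- The sum over all points, cycle by cycle. -/
theorem sum_eq_sum_permCycles {E A : Type*} [Fintype E] [AddCommMonoid A] (σ : Perm E)
    [Fintype (PermCycles σ)] (G : E → A) :
    ∑ e, G e = ∑ c : PermCycles σ,
      ∑ k ∈ Finset.range (Function.minimalPeriod σ c.out), G ((σ ^ k) c.out) := by
  classical
  rw [← Finset.sum_fiberwise Finset.univ (fun e => (Quotient.mk _ e : PermCycles σ))]
  refine Finset.sum_congr rfl fun c _ => ?_
  symm
  refine Finset.sum_nbij (fun k => (σ ^ k) c.out) ?_ ?_ ?_ fun _ _ => rfl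
  · intro k _
    simp only [Finset.mem_filter, Finset.mem_univ, true_and]
    conv_rhs => rw [← Quotient.out_eq c]
    exact Quotient.sound (Perm.SameCycle.symm ⟨k, by simp⟩)
  · intro k hk l hl h
    simp only [Finset.coe_range, Set.mem_Iio] at hk hl
    simp only [← Perm.iterate_eq_pow] at h
    exact Function.iterate_injOn_Iio_minimalPeriod hk hl h
  · intro e he
    simp only [Finset.coe_filter, Finset.mem_univ, true_and, Set.mem_ofPred_eq] at he
    have hs : σ.SameCycle c.out e := by
      refine Quotient.exact (s := Perm.SameCycle.setoid σ) ?_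
      rw [Quotient.out_eq, ← he]
    obtain ⟨k, hk⟩ := hs.exists_nat_pow_eq
    have hp : 0 < Function.minimalPeriod σ c.out :=
      Function.minimalPeriod_pos_of_mem_periodicPts
        (σ.injective.mem_periodicPts _)
    refine ⟨k % Function.minimalPeriod σ c.out, ?_, ?_⟩
    · simpa using Nat.mod_lt _ hp
    · simp only [← Perm.iterate_eq_pow] at hk ⊢
      rw [Function.iterate_mod_minimalPeriod_eq, hk]

/-- A function that is invariant under a permutation is constant on its cycles. -/
theorem Perm.SameCycle.apply_eq_of_invariant {E A : Type*} {σ : Perm E} {f : E → A}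
    (hf : ∀ e, f (σ e) = f e) {x y : E} (h : σ.SameCycle x y) : f x = f y := by
  obtain ⟨k, rfl⟩ := h
  have hinv : ∀ e, f (σ⁻¹ e) = f e := fun e => by rw [← hf (σ⁻¹ e)]; simp
  induction k with
  | zero => simp
  | succ k ih => rw [add_comm, zpow_add, Perm.mul_apply, zpow_one, hf, ← ih]
  | pred k ih => rw [sub_eq_add_neg, add_comm, zpow_add, Perm.mul_apply, zpow_neg_one, hinv, ← ih]

/-- A function whose sum over every cycle vanishes is a difference along the permutation. -/
theorem exists_apply_sub_of_sum_cycle_eq_zero {E : Type*} [Finite E] (σ : Perm E) (c : E → ℚ)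
    (hc : ∀ e, ∑ k ∈ Finset.range (Function.minimalPeriod σ e), c ((σ ^ k) e) = 0) :
    ∃ P : E → ℚ, ∀ e, P (σ e) - P e = c e := by
  -- Weighting the `k`-th value by `k` and dividing by the cycle length gives a primitive without
  -- choosing a base point on each cycle; summation by parts verifies it.
  refine ⟨fun e => (∑ k ∈ Finset.range (Function.minimalPeriod σ e), (k : ℚ) * c ((σ ^ k) e)) /
    Function.minimalPeriod σ e, fun e => ?_⟩
  have hper : e ∈ Function.periodicPts σ := σ.injective.mem_periodicPts _
  have hp : 0 < Function.minimalPeriod σ e := Function.minimalPeriod_pos_of_mem_periodicPts hper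
  have hend : (σ ^ Function.minimalPeriod σ e) e = e := by
    rw [← Perm.iterate_eq_pow, Function.iterate_minimalPeriod]
  have hce := hc e
  simp only [Function.minimalPeriod_apply hper]
  generalize Function.minimalPeriod σ e = n at *
  obtain ⟨m, rfl⟩ : ∃ m, n = m + 1 := ⟨n - 1, by omega⟩
  have hshift : ∀ k : ℕ, (σ ^ k) (σ e) = (σ ^ (k + 1)) e := fun k => by rw [pow_succ]; rfl
  have key : ∀ n : ℕ, ∑ k ∈ Finset.range n, (k : ℚ) * c ((σ ^ (k + 1)) e)
      - ∑ k ∈ Finset.range n, (k : ℚ) * c ((σ ^ k) e)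
      = n * c ((σ ^ n) e) - ∑ k ∈ Finset.range n, c ((σ ^ (k + 1)) e) := by
    intro n
    induction n with
    | zero => simp
    | succ n ih =>
      rw [Finset.sum_range_succ, Finset.sum_range_succ, Finset.sum_range_succ]
      push_cast
      linear_combination ih
  have h1 := key (m + 1)
  have h2 : ∑ k ∈ Finset.range (m + 1), c ((σ ^ (k + 1)) e) = 0 := by
    have := Finset.sum_range_succ' (fun k => c ((σ ^ k) e)) (m + 1)
    rw [Finset.sum_range_succ, hce, hend] at this
    simpa using this
  simp only [hshift]
  rw [← sub_div, h1, h2, hend, sub_zero]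
  field_simp

/-! ### Closed cochains, potentials and the cup product -/

namespace TorusDimer

variable {E : Type*} [Fintype E] (D : TorusDimer E)

/-- The functions on the edges that are invariant around all nodes are constant. -/
theorem eq_of_invariant {A : Type*} {f : E → A} (hw : ∀ e, f (D.white e) = f e)
    (hb : ∀ e, f (D.black e) = f e) (x y : E) : f x = f y := by
  obtain ⟨⟨g, hg⟩, hxy⟩ := D.connected.exists_smul_eq x y
  have h : ∀ z, f (g z) = f z := by
    clear hxy
    induction hg using Subgroup.closure_induction with
    | mem g hg =>
      rcases hg with rfl | rfl
      · exact hw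
      · exact hb
    | one => simp
    | mul a b _ _ iha ihb => intro z; rw [Perm.mul_apply, iha, ihb]
    | inv a _ ih => intro z; rw [← ih]; simp
  rw [← hxy]
  exact (h x).symm

theorem nonempty_edge {E : Type*} [Fintype E] (D : TorusDimer E) : Nonempty E := by
  by_contra h
  have : IsEmpty E := not_nonempty_iff.1 h
  have : IsEmpty D.Face := ⟨fun f => this.elim f.out⟩
  have h2 := D.degree
  simp [finsum_of_isEmpty] at h2

theorem facePerm_apply (e : E) : D.facePerm e = D.black⁻¹ (D.white⁻¹ e) := rfl

/-- The function `P` on the edges, considered as a function on the black corners of the faces, is a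
potential of the cochain `f`: along the boundary of each face, it changes by the values of `f`. -/
def IsPotential (x : (E → ℚ) × (E → ℚ)) : Prop :=
  ∀ e, x.1 (D.facePerm e) - x.1 e = x.2 (D.white⁻¹ e) - x.2 e

/-- Twice the cup product of two closed cochains with given potentials, integrated over the
surface. -/
def cupPairing (x y : (E → ℚ) × (E → ℚ)) : ℚ :=
  ∑ e, (x.1 e * y.1 (D.facePerm e) - x.1 (D.facePerm e) * y.1 e
    - x.2 e * y.2 (D.white⁻¹ e) + x.2 (D.white⁻¹ e) * y.2 e)

theorem cupPairing_add_left (x x' y : (E → ℚ) × (E → ℚ)) :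
    D.cupPairing (x + x') y = D.cupPairing x y + D.cupPairing x' y := by
  simp only [cupPairing, ← Finset.sum_add_distrib, Prod.fst_add, Prod.snd_add, Pi.add_apply]
  exact Finset.sum_congr rfl fun e _ => by ring

theorem cupPairing_smul_left (a : ℚ) (x y : (E → ℚ) × (E → ℚ)) :
    D.cupPairing (a • x) y = a * D.cupPairing x y := by
  simp only [cupPairing, Finset.mul_sum, Prod.smul_fst, Prod.smul_snd, Pi.smul_apply, smul_eq_mul]
  exact Finset.sum_congr rfl fun e _ => by ring

theorem cupPairing_swap (x y : (E → ℚ) × (E → ℚ)) : D.cupPairing x y = -D.cupPairing y x := by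
  simp only [cupPairing, ← Finset.sum_neg_distrib]
  exact Finset.sum_congr rfl fun e _ => by ring

theorem cupPairing_self (x : (E → ℚ) × (E → ℚ)) : D.cupPairing x x = 0 := by
  linarith [D.cupPairing_swap x x]

/-- The sum telescopes around each face. With the next two lemmas this makes the pairing depend only
on cohomology classes. -/
theorem cupPairing_face {c : E → ℚ} (hc : ∀ e, c (D.facePerm e) = c e)
    (y : (E → ℚ) × (E → ℚ)) : D.cupPairing (c, 0) y = 0 := by
  have h := Equiv.sum_comp D.facePerm fun e => c e * y.1 e
  simp only [hc] at h
  simp [cupPairing, hc, Finset.sum_sub_distrib, h]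

theorem cupPairing_white {h : E → ℚ} (hh : ∀ e, h (D.white e) = h e)
    (y : (E → ℚ) × (E → ℚ)) : D.cupPairing (0, h) y = 0 := by
  have hh' : ∀ e, h (D.white⁻¹ e) = h e := fun e => by rw [← hh (D.white⁻¹ e)]; simp
  have h := Equiv.sum_comp D.white⁻¹ fun e => h e * y.2 e
  simp only [hh'] at h
  simp only [cupPairing, Pi.zero_apply, zero_mul, hh', sub_self, zero_sub, Finset.sum_add_distrib,
    Finset.sum_neg_distrib, h, neg_add_cancel]

/-- Potentials live at black corners only, so a function on black nodes is its own potential, while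
one on white nodes has potential zero. Replacing the potential differences of `y` by its values
makes the sum telescope. -/
theorem cupPairing_black {g : E → ℚ} (hg : ∀ e, g (D.black e) = g e)
    {y : (E → ℚ) × (E → ℚ)} (hy : D.IsPotential y) : D.cupPairing (g, g) y = 0 := by
  have hg' : ∀ e, g (D.black⁻¹ e) = g e := fun e => by rw [← hg (D.black⁻¹ e)]; simp
  have h1 := Equiv.sum_comp D.white⁻¹ fun e => g e * (y.1 (D.black⁻¹ e) - y.2 e)
  have h2 := Equiv.sum_comp D.black⁻¹ fun e => g e * y.1 e
  simp only [hg'] at h2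
  simp only [mul_sub, Finset.sum_sub_distrib] at h1
  have h3 : D.cupPairing (g, g) y = ∑ e, (g e * y.1 e - g e * y.2 e
      - (g (D.white⁻¹ e) * y.1 (D.black⁻¹ (D.white⁻¹ e))
        - g (D.white⁻¹ e) * y.2 (D.white⁻¹ e))) := by
    refine Finset.sum_congr rfl fun e _ => ?_
    have := hy e
    simp only [facePerm_apply, hg'] at this ⊢
    linear_combination (g e + g (D.white⁻¹ e)) * this
  rw [h3]
  simp only [Finset.sum_sub_distrib]
  linarith

end TorusDimer

/-! ### Areas of faces and the degree -/

theorem twiceArea_append_pair (l : List (ℤ × ℤ)) (a b : ℤ × ℤ) :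
    twiceArea (l ++ [a, b]) = twiceArea l + wedge l.sum (a + b) + wedge a b := by
  induction l with
  | nil => simp [twiceArea, wedge]
  | cons d l ih =>
    simp only [List.cons_append, twiceArea, ih, List.sum_append, List.sum_cons, List.sum_nil]
    simp only [wedge, Prod.fst_add, Prod.snd_add, Prod.fst_zero, Prod.snd_zero]
    ring

namespace BipartiteMap

variable {E : Type*} (D : BipartiteMap E)

/-- The first `n` pairs of steps of the boundary walk of a face. -/
def faceStepsPrefix (d : E → ℤ × ℤ) (e : E) (n : ℕ) : List (ℤ × ℤ) :=
  (List.range n).flatMap fun k =>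
    [-d ((D.facePerm ^ k) e), d (D.white⁻¹ ((D.facePerm ^ k) e))]

theorem faceStepsPrefix_succ (d : E → ℤ × ℤ) (e : E) (n : ℕ) :
    D.faceStepsPrefix d e (n + 1) = D.faceStepsPrefix d e n ++
      [-d ((D.facePerm ^ n) e), d (D.white⁻¹ ((D.facePerm ^ n) e))] := by
  simp [faceStepsPrefix, List.range_succ]

theorem sum_faceStepsPrefix (d : E → ℤ × ℤ) (e : E) (n : ℕ) :
    (D.faceStepsPrefix d e n).sum = ∑ k ∈ Finset.range n,
      (d (D.white⁻¹ ((D.facePerm ^ k) e)) - d ((D.facePerm ^ k) e)) := by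
  induction n with
  | zero => simp [faceStepsPrefix]
  | succ n ih =>
    rw [faceStepsPrefix_succ, List.sum_append, ih, Finset.sum_range_succ]
    simp [neg_add_eq_sub]

end BipartiteMap

namespace TorusDimer

variable {E : Type*} [Fintype E] (D : TorusDimer E)

theorem exists_isPotential_step : ∃ P Q : E → ℚ,
    D.IsPotential (P, fun e => ((D.step e).1 : ℚ)) ∧
      D.IsPotential (Q, fun e => ((D.step e).2 : ℚ)) := by
  have hc : ∀ e, ∑ k ∈ Finset.range (Function.minimalPeriod D.facePerm e),
      (D.step (D.white⁻¹ ((D.facePerm ^ k) e)) - D.step ((D.facePerm ^ k) e)) = 0 := fun e => by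
    rw [← BipartiteMap.sum_faceStepsPrefix]
    exact D.closed e
  obtain ⟨P, hP⟩ := exists_apply_sub_of_sum_cycle_eq_zero D.facePerm
    (fun e => ((D.step (D.white⁻¹ e)).1 : ℚ) - (D.step e).1) fun e => by
      have := congrArg Prod.fst (hc e)
      rw [Prod.fst_sum] at this
      exact_mod_cast this
  obtain ⟨Q, hQ⟩ := exists_apply_sub_of_sum_cycle_eq_zero D.facePerm
    (fun e => ((D.step (D.white⁻¹ e)).2 : ℚ) - (D.step e).2) fun e => by
      have := congrArg Prod.snd (hc e)
      rw [Prod.snd_sum] at this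
      exact_mod_cast this
  exact ⟨P, Q, hP, hQ⟩

variable {D} {P Q : E → ℚ}

theorem sum_range_of_isPotential {x : (E → ℚ) × (E → ℚ)} (hx : D.IsPotential x) (e : E) (n : ℕ) :
    ∑ k ∈ Finset.range n, (x.2 (D.white⁻¹ ((D.facePerm ^ k) e)) - x.2 ((D.facePerm ^ k) e)) =
      x.1 ((D.facePerm ^ n) e) - x.1 e := by
  induction n with
  | zero => simp
  | succ n ih =>
    rw [Finset.sum_range_succ, ih, ← hx, pow_succ', Perm.mul_apply]
    ring

/-- This is the shoelace formula with `(P, Q)` as coordinates of the black corners: each pair of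
steps also contributes the triangle at a white corner. The last term is the chord that closes the
polygon and vanishes after a full turn. -/
theorem twiceArea_faceStepsPrefix (hP : D.IsPotential (P, fun e => ((D.step e).1 : ℚ)))
    (hQ : D.IsPotential (Q, fun e => ((D.step e).2 : ℚ))) (e : E) (n : ℕ) :
    (twiceArea (D.faceStepsPrefix D.step e n) : ℚ) = (∑ k ∈ Finset.range n,
      (fun e => P e * Q (D.facePerm e) - P (D.facePerm e) * Q e
        - ((D.step e).1 : ℚ) * ((D.step (D.white⁻¹ e)).2 : ℚ)
        + ((D.step (D.white⁻¹ e)).1 : ℚ) * ((D.step e).2 : ℚ)) ((D.facePerm ^ k) e))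
      - (P e * Q ((D.facePerm ^ n) e) - P ((D.facePerm ^ n) e) * Q e) := by
  induction n with
  | zero => simp [BipartiteMap.faceStepsPrefix, twiceArea, mul_comm]
  | succ n ih =>
    have h1 := sum_range_of_isPotential hP e n
    have h2 := sum_range_of_isPotential hQ e n
    have h3 := hP ((D.facePerm ^ n) e)
    have h4 := hQ ((D.facePerm ^ n) e)
    rw [BipartiteMap.faceStepsPrefix_succ, twiceArea_append_pair,
      BipartiteMap.sum_faceStepsPrefix, Finset.sum_range_succ, pow_succ', Perm.mul_apply]
    simp only [wedge, Prod.fst_sum, Prod.snd_sum, Prod.fst_sub, Prod.snd_sub, Prod.fst_add,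
      Prod.snd_add, Prod.fst_neg, Prod.snd_neg]
    simp only [Int.cast_add, Int.cast_sub, Int.cast_mul, Int.cast_neg, Int.cast_sum]
    simp only at h1 h2 h3 h4 ih ⊢
    rw [h1, h2, ih]
    linear_combination (-(P ((D.facePerm ^ n) e) - P e)) * h4 + (Q ((D.facePerm ^ n) e) - Q e) * h3

theorem cupPairing_step (hP : D.IsPotential (P, fun e => ((D.step e).1 : ℚ)))
    (hQ : D.IsPotential (Q, fun e => ((D.step e).2 : ℚ))) :
    D.cupPairing (P, fun e => ((D.step e).1 : ℚ)) (Q, fun e => ((D.step e).2 : ℚ)) = 2 := by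
  classical
  have hdeg := D.degree
  rw [finsum_eq_sum_of_fintype] at hdeg
  rw [cupPairing, sum_eq_sum_permCycles D.facePerm]
  have : ((2 : ℤ) : ℚ) = 2 := by norm_num
  rw [← this, ← hdeg, Int.cast_sum]
  refine Finset.sum_congr rfl fun c _ => ?_
  have h := twiceArea_faceStepsPrefix hP hQ c.out (Function.minimalPeriod D.facePerm c.out)
  have hend : (D.facePerm ^ Function.minimalPeriod D.facePerm c.out) c.out = c.out := by
    rw [← Perm.iterate_eq_pow, Function.iterate_minimalPeriod]
  rw [hend, sub_self, sub_zero] at h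
  exact h.symm

/-! ### The first cohomology, by counting dimensions -/

variable (D)

/-- The linear map whose kernel consists of the cochains with their potentials. -/
def potentialDefect : ((E → ℚ) × (E → ℚ)) →ₗ[ℚ] (E → ℚ) where
  toFun x e := (x.1 (D.facePerm e) - x.1 e) - (x.2 (D.white⁻¹ e) - x.2 e)
  map_add' x y := by ext e; simp; ring
  map_smul' a x := by ext e; simp; ring

theorem mem_ker_potentialDefect {x : (E → ℚ) × (E → ℚ)} :
    x ∈ LinearMap.ker D.potentialDefect ↔ D.IsPotential x := by
  simp only [LinearMap.mem_ker, funext_iff, IsPotential]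
  exact forall_congr' fun e => sub_eq_zero

theorem single_sub_single_mem_range [DecidableEq E] (x y : E) :
    (Pi.single x 1 - Pi.single y 1 : E → ℚ) ∈ LinearMap.range D.potentialDefect := by
  rw [← Submodule.Quotient.eq]
  refine D.eq_of_invariant (f := fun x => (Submodule.Quotient.mk (Pi.single x 1) :
    (E → ℚ) ⧸ LinearMap.range D.potentialDefect)) ?_ ?_ x y
  · intro e
    rw [Submodule.Quotient.eq]
    -- Changing the cochain at `e` alone affects just two defects, at `e` and at `white e`.
    refine ⟨(0, -Pi.single e 1), ?_⟩
    ext i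
    have : D.white⁻¹ i = e ↔ i = D.white e := Perm.inv_eq_iff_eq
    simp only [potentialDefect, LinearMap.coe_mk, AddHom.coe_mk, Pi.zero_apply, Pi.neg_apply,
      Pi.sub_apply, Pi.single_apply, this]
    ring
  · have hw : ∀ e, (Submodule.Quotient.mk (Pi.single (D.white e) 1) :
        (E → ℚ) ⧸ LinearMap.range D.potentialDefect) =
        Submodule.Quotient.mk (Pi.single e 1) := by
      intro e
      rw [Submodule.Quotient.eq]
      refine ⟨(0, -Pi.single e 1), ?_⟩
      ext i
      have : D.white⁻¹ i = e ↔ i = D.white e := Perm.inv_eq_iff_eq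
      simp only [potentialDefect, LinearMap.coe_mk, AddHom.coe_mk, Pi.zero_apply, Pi.neg_apply,
        Pi.sub_apply, Pi.single_apply, this]
      ring
    intro e
    rw [← hw, Submodule.Quotient.eq]
    -- Changing the potential at `e` alone affects the defects at `e` and at its predecessor `white
    -- (black e)` along the face.
    refine ⟨(Pi.single e 1, 0), ?_⟩
    ext i
    have : D.facePerm i = e ↔ i = D.white (D.black e) := by
      rw [facePerm_apply, Perm.inv_eq_iff_eq, Perm.inv_eq_iff_eq]
    simp only [potentialDefect, LinearMap.coe_mk, AddHom.coe_mk, Pi.zero_apply,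
      Pi.sub_apply, Pi.single_apply, this]
    ring

/-- All unit vectors agree in the cokernel, so a single one spans it. -/
theorem card_le_finrank_range_potentialDefect :
    Fintype.card E ≤ Module.finrank ℚ (LinearMap.range D.potentialDefect) + 1 := by
  classical
  obtain ⟨x₀⟩ := D.nonempty_edge
  set U := LinearMap.range D.potentialDefect
  have htop : U ⊔ Submodule.span ℚ {Pi.single x₀ 1} = ⊤ := by
    rw [eq_top_iff, ← (Pi.basisFun ℚ E).span_eq, Submodule.span_le]
    rintro _ ⟨x, rfl⟩
    have h := add_mem
      (Submodule.mem_sup_left (T := Submodule.span ℚ {(Pi.single x₀ 1 : E → ℚ)})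
        (D.single_sub_single_mem_range x x₀))
      (Submodule.mem_sup_right (S := U) (Submodule.mem_span_singleton_self _))
    simpa using h
  have h1 := Submodule.finrank_add_le_finrank_add_finrank U
    (Submodule.span ℚ {(Pi.single x₀ 1 : E → ℚ)})
  rw [htop, finrank_top, Module.finrank_fintype_fun_eq_card] at h1
  have h2 := finrank_span_singleton (K := ℚ) (v := (Pi.single x₀ 1 : E → ℚ)) (by simp)
  omega

variable (x y : (E → ℚ) × (E → ℚ))

/-- The closed cochains with potentials that are combinations of `x`, `y`, coboundaries of functions
on the nodes, and changes of the potential by constants on the faces. -/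
def closedSpan : ((D.Face → ℚ) × (D.White → ℚ) × (D.Black → ℚ) × ℚ × ℚ) →ₗ[ℚ]
    ((E → ℚ) × (E → ℚ)) where
  toFun t := ((fun e => t.1 (Quotient.mk _ e)) + fun e => t.2.2.1 (D.blackEnd e),
    (fun e => t.2.1 (D.whiteEnd e)) + fun e => t.2.2.1 (D.blackEnd e))
      + (t.2.2.2.1 • x + t.2.2.2.2 • y)
  map_add' s t := by ext e <;> simp <;> ring
  map_smul' a t := by ext e <;> simp <;> ring

theorem face_facePerm (e : E) :
    (Quotient.mk _ (D.facePerm e) : D.Face) = Quotient.mk _ e :=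
  Quotient.sound (Perm.sameCycle_apply_left.2 (Perm.SameCycle.refl _ _))

theorem whiteEnd_white (e : E) : D.whiteEnd (D.white e) = D.whiteEnd e :=
  Quotient.sound (Perm.sameCycle_apply_left.2 (Perm.SameCycle.refl _ _))

theorem blackEnd_black (e : E) : D.blackEnd (D.black e) = D.blackEnd e :=
  Quotient.sound (Perm.sameCycle_apply_left.2 (Perm.SameCycle.refl _ _))

variable {x y}

/-- Only the coefficients of `x` and `y` survive, so pairing with `x` and `y` recovers them. -/
theorem cupPairing_closedSpan (t) {z : (E → ℚ) × (E → ℚ)} (hz : D.IsPotential z) :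
    D.cupPairing (D.closedSpan x y t) z =
      t.2.2.2.1 * D.cupPairing x z + t.2.2.2.2 * D.cupPairing y z := by
  have h : D.closedSpan x y t = ((fun e => t.1 (Quotient.mk _ e)), 0)
      + (0, fun e => t.2.1 (D.whiteEnd e))
      + ((fun e => t.2.2.1 (D.blackEnd e)), fun e => t.2.2.1 (D.blackEnd e))
      + (t.2.2.2.1 • x + t.2.2.2.2 • y) := by
    ext e <;> simp [closedSpan]
  rw [h, cupPairing_add_left, cupPairing_add_left, cupPairing_add_left, cupPairing_add_left,
    cupPairing_smul_left, cupPairing_smul_left, cupPairing_face, cupPairing_white,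
    cupPairing_black _ _ hz]
  · ring
  · exact fun e => by rw [D.blackEnd_black]
  · exact fun e => by rw [D.whiteEnd_white]
  · exact fun e => by rw [D.face_facePerm]

theorem isPotential_closedSpan (hx : D.IsPotential x) (hy : D.IsPotential y) (t) :
    D.IsPotential (D.closedSpan x y t) := by
  intro e
  have h1 : D.whiteEnd (D.white⁻¹ e) = D.whiteEnd e := by
    rw [← D.whiteEnd_white (D.white⁻¹ e)]; simp
  have h2 : D.blackEnd (D.black⁻¹ (D.white⁻¹ e)) = D.blackEnd (D.white⁻¹ e) := by
    rw [← D.blackEnd_black (D.black⁻¹ (D.white⁻¹ e))]; simp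
  have h3 := hx e
  have h4 := hy e
  simp only [closedSpan, LinearMap.coe_mk, AddHom.coe_mk, Prod.fst_add, Prod.snd_add, Pi.add_apply,
    Prod.smul_fst, Prod.smul_snd, Pi.smul_apply, smul_eq_mul, face_facePerm, h1]
  rw [facePerm_apply] at h3 h4 ⊢
  rw [h2]
  linear_combination t.2.2.2.1 * h3 + t.2.2.2.2 * h4

theorem finrank_ker_closedSpan_le (hx : D.IsPotential x) (hy : D.IsPotential y)
    (hxy : D.cupPairing x y ≠ 0) :
    Module.finrank ℚ (LinearMap.ker (D.closedSpan x y)) ≤ 1 := by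
  classical
  obtain ⟨x₀⟩ := D.nonempty_edge
  -- The only redundancy is a common constant: adding it on faces and white nodes cancels
  -- subtracting it on black nodes.
  have hle : LinearMap.ker (D.closedSpan x y) ≤
      Submodule.span ℚ {((fun _ => 1), (fun _ => 1), (fun _ => -1), 0, 0)} := by
    intro t ht
    rw [LinearMap.mem_ker] at ht
    have h1 := D.cupPairing_closedSpan (x := x) (y := y) t hx
    have h2 := D.cupPairing_closedSpan (x := x) (y := y) t hy
    have h0 : ∀ z, D.cupPairing 0 z = 0 := fun z => by simp [cupPairing]
    rw [ht, h0, cupPairing_self, D.cupPairing_swap y x] at h1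
    rw [ht, h0, cupPairing_self] at h2
    have hb : t.2.2.2.2 = 0 := by
      by_contra h
      exact hxy (by simpa [h] using h1.symm)
    have ha : t.2.2.2.1 = 0 := by
      by_contra h
      exact hxy (by simpa [h] using h2.symm)
    have hf : ∀ e, t.1 (Quotient.mk _ e) + t.2.2.1 (D.blackEnd e) = 0 := fun e => by
      simpa [closedSpan, ha, hb] using congrFun (congrArg Prod.fst ht) e
    have hg : ∀ e, t.2.1 (D.whiteEnd e) + t.2.2.1 (D.blackEnd e) = 0 := fun e => by
      simpa [closedSpan, ha, hb] using congrFun (congrArg Prod.snd ht) e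
    have hconst : ∀ e, t.2.2.1 (D.blackEnd e) = t.2.2.1 (D.blackEnd x₀) := fun e =>
      D.eq_of_invariant (f := fun e => t.2.2.1 (D.blackEnd e))
        (fun e => by
          have h3 := hg e
          have h4 := hg (D.white e)
          rw [whiteEnd_white] at h4
          linarith)
        (fun e => by rw [blackEnd_black]) e x₀
    rw [Submodule.mem_span_singleton]
    refine ⟨-t.2.2.1 (D.blackEnd x₀), ?_⟩
    refine Prod.ext ?_ (Prod.ext ?_ (Prod.ext ?_ (Prod.ext ?_ ?_)))
    · funext f
      induction f using Quotient.inductionOn with | _ e =>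
      have := hf e
      have := hconst e
      simp
      linarith
    · funext f
      induction f using Quotient.inductionOn with | _ e =>
      have := hg e
      have := hconst e
      simp only [Prod.smul_fst, Prod.smul_snd, Pi.smul_apply, smul_eq_mul]
      change _ = t.2.1 (D.whiteEnd e)
      linarith
    · funext f
      induction f using Quotient.inductionOn with | _ e =>
      have := hconst e
      simp only [Prod.smul_fst, Prod.smul_snd, Pi.smul_apply, smul_eq_mul]
      change _ = t.2.2.1 (D.blackEnd e)
      linarith
    · simp [ha]
    · simp [hb]
  refine (Submodule.finrank_mono hle).trans ?_
  exact (finrank_span_le_card _).trans (by simp)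

/-- The first cohomology is spanned by the classes of `x` and `y`. -/
theorem exists_closedSpan_eq (hx : D.IsPotential x) (hy : D.IsPotential y)
    (hxy : D.cupPairing x y ≠ 0) {z : (E → ℚ) × (E → ℚ)} (hz : D.IsPotential z) :
    ∃ t, D.closedSpan x y t = z := by
  classical
  have hle : LinearMap.range (D.closedSpan x y) ≤ LinearMap.ker D.potentialDefect := by
    rintro _ ⟨t, rfl⟩
    exact D.mem_ker_potentialDefect.2 (D.isPotential_closedSpan hx hy t)
  have h1 := LinearMap.finrank_range_add_finrank_ker D.potentialDefect
  have h2 := LinearMap.finrank_range_add_finrank_ker (D.closedSpan x y)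
  have h3 := D.finrank_ker_closedSpan_le hx hy hxy
  have h4 := D.card_le_finrank_range_potentialDefect
  have h5 := D.euler
  simp only [Nat.card_eq_fintype_card] at h5
  simp only [Module.finrank_prod, Module.finrank_fintype_fun_eq_card, Module.finrank_self] at h1 h2
  -- By Euler the domain of `closedSpan` has dimension `card E + 2`, so its range has dimension at
  -- least `card E + 1`, while the closed cochains have at most that dimension.
  have heq := Submodule.eq_of_le_of_finrank_le hle (by omega)
  have hmem := D.mem_ker_potentialDefect.2 hz
  rw [← heq] at hmem
  exact hmem

end TorusDimer

/-! ### Zigzag paths and Poincaré duality -/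

namespace TorusDimer

variable {E : Type*} [Fintype E] (D : TorusDimer E)

theorem zigzagToWhite_inv_black (e : E) :
    D.zigzagToWhite (D.black⁻¹ e) = D.zigzagToBlack e := by
  refine Quotient.sound (s := Perm.SameCycle.setoid D.zigzagPerm) ?_
  have h : D.black⁻¹ e = D.zigzagPerm (D.white⁻¹ e) := by
    simp [BipartiteMap.zigzagPerm]
  rw [h]
  exact Perm.sameCycle_apply_left.2 (Perm.SameCycle.refl _ _)

theorem zigzagToBlack_white (e : E) : D.zigzagToBlack (D.white e) = D.zigzagToWhite e := by
  simp [BipartiteMap.zigzagToBlack, BipartiteMap.zigzagToWhite]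

open Classical in
/-- The indicator function of the edges that a zigzag path leaves towards white. -/
noncomputable def zigzagIndicator (z : D.Zigzag) (e : E) : ℚ :=
  if D.zigzagToWhite e = z then 1 else 0

/-- The cochain that counts the crossings of an edge with a zigzag path, and its potential. -/
noncomputable def zigzagCochain (z : D.Zigzag) : (E → ℚ) × (E → ℚ) :=
  (D.zigzagIndicator z, fun e => D.zigzagIndicator z e + D.zigzagIndicator z (D.white⁻¹ e))

variable {D}

theorem zigzagIndicator_inv_black (z : D.Zigzag) (e : E) :
    D.zigzagIndicator z (D.black⁻¹ e) = D.zigzagIndicator z (D.white⁻¹ e) := by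
  have h : D.zigzagToWhite (D.black⁻¹ e) = D.zigzagToWhite (D.white⁻¹ e) :=
    D.zigzagToWhite_inv_black e
  rw [zigzagIndicator, zigzagIndicator, h]

theorem isPotential_zigzagCochain (z : D.Zigzag) : D.IsPotential (D.zigzagCochain z) := by
  intro e
  simp only [zigzagCochain, facePerm_apply, zigzagIndicator_inv_black]
  ring

/-- Reindexing turns the pairing into twice the value of `y` on the closed path `z`. All crossings
count with the same sign because zigzag paths turn counterclockwise around white and clockwise
around black nodes. -/
theorem cupPairing_zigzagCochain (z : D.Zigzag) {y : (E → ℚ) × (E → ℚ)} (hy : D.IsPotential y) :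
    D.cupPairing (D.zigzagCochain z) y =
      2 * ∑ e, D.zigzagIndicator z e * (y.2 (D.white e) - y.2 e) := by
  set u := D.zigzagIndicator z with hu
  have hb : ∀ e, u (D.black⁻¹ e) = u (D.white⁻¹ e) := zigzagIndicator_inv_black z
  have h1 := Equiv.sum_comp D.white⁻¹ fun e =>
    u (D.white⁻¹ e) * (y.1 (D.black⁻¹ e) - y.2 e)
  have h2 := Equiv.sum_comp D.black⁻¹ fun e => u e * y.1 e
  have h3 := Equiv.sum_comp D.white⁻¹ fun e => u e * y.2 (D.white e)
  have h4 := Equiv.sum_comp D.white⁻¹ fun e => u e * y.2 e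
  have hww : ∀ e, D.white (D.white⁻¹ e) = e := fun e => D.white.apply_symm_apply e
  simp only [hb, hww] at h2 h3
  have key : D.cupPairing (D.zigzagCochain z) y =
      ∑ e, ((u e * (y.1 e - y.2 e) - u (D.white⁻¹ (D.white⁻¹ e)) *
        (y.1 (D.black⁻¹ (D.white⁻¹ e)) - y.2 (D.white⁻¹ e)))
        - u (D.white⁻¹ e) * y.2 (D.white⁻¹ e) + u (D.white⁻¹ e) * y.2 e) := by
    refine Finset.sum_congr rfl fun e _ => ?_
    have := hy e
    simp only [facePerm_apply, zigzagCochain, ← hu, hb] at this ⊢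
    linear_combination (u e + u (D.white⁻¹ (D.white⁻¹ e))) * this
  rw [key]
  simp only [mul_sub, Finset.sum_add_distrib, Finset.sum_sub_distrib] at h1 ⊢
  linarith

theorem winding_fst (z : D.Zigzag) : ((D.winding z).1 : ℚ) =
    ∑ e, D.zigzagIndicator z e * (((D.step (D.white e)).1 : ℚ) - (D.step e).1) := by
  rw [winding, Prod.fst_sum, Int.cast_sum, Finset.sum_filter]
  refine Finset.sum_congr rfl fun e _ => ?_
  by_cases h : D.zigzagToWhite e = z <;> simp [zigzagIndicator, h]

theorem winding_snd (z : D.Zigzag) : ((D.winding z).2 : ℚ) =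
    ∑ e, D.zigzagIndicator z e * (((D.step (D.white e)).2 : ℚ) - (D.step e).2) := by
  rw [winding, Prod.snd_sum, Int.cast_sum, Finset.sum_filter]
  refine Finset.sum_congr rfl fun e _ => ?_
  by_cases h : D.zigzagToWhite e = z <;> simp [zigzagIndicator, h]

/-- The crossing cochain of a zigzag path is Poincaré dual to its winding number. -/
theorem exists_zigzagCochain_eq (z : D.Zigzag) (x y : (E → ℚ) × (E → ℚ))
    (hx : D.IsPotential x) (hy : D.IsPotential y) (hx2 : x.2 = fun e => ((D.step e).1 : ℚ))
    (hy2 : y.2 = fun e => ((D.step e).2 : ℚ)) :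
    ∃ t, D.closedSpan x y t = D.zigzagCochain z ∧ t.2.2.2.1 = (D.winding z).2 ∧
      t.2.2.2.2 = -(D.winding z).1 := by
  have hxy : D.cupPairing x y = 2 := by
    obtain ⟨P, f⟩ := x
    obtain ⟨Q, g⟩ := y
    simp only at hx2 hy2
    subst hx2 hy2
    exact cupPairing_step hx hy
  obtain ⟨t, ht⟩ := D.exists_closedSpan_eq hx hy (by rw [hxy]; norm_num)
    (isPotential_zigzagCochain z)
  refine ⟨t, ht, ?_, ?_⟩
  · have h := D.cupPairing_closedSpan (x := x) (y := y) t hy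
    rw [ht, cupPairing_zigzagCochain z hy, cupPairing_self, hxy, hy2, ← winding_snd] at h
    linarith
  · have h := D.cupPairing_closedSpan (x := x) (y := y) t hx
    rw [ht, cupPairing_zigzagCochain z hx, cupPairing_self, D.cupPairing_swap y x, hxy, hx2,
      ← winding_fst] at h
    linarith

open Classical in
/-- The wedge of the windings is the signed number of intersections. -/
theorem wedge_winding (z z' : D.Zigzag) : wedge (D.winding z) (D.winding z') =
    ∑ e, ((if D.PosIntersection e z z' then 1 else 0) -
      if D.PosIntersection e z' z then 1 else 0) := by
  obtain ⟨P, Q, hP, hQ⟩ := D.exists_isPotential_step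
  obtain ⟨t, ht, ha, hb⟩ := exists_zigzagCochain_eq z _ _ hP hQ rfl rfl
  have hz' := isPotential_zigzagCochain z'
  -- Two evaluations of the pairing of the cochains of `z` and `z'`: by their classes, and by
  -- running along `z` and counting crossings with `z'`.
  have h1 := D.cupPairing_closedSpan (x := (P, fun e => ((D.step e).1 : ℚ)))
    (y := (Q, fun e => ((D.step e).2 : ℚ))) t hz'
  rw [ht, ha, hb, cupPairing_zigzagCochain z hz', cupPairing_swap, cupPairing_zigzagCochain z' hP,
    cupPairing_swap, cupPairing_zigzagCochain z' hQ, ← winding_fst, ← winding_snd] at h1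
  have h2 : ∑ e, D.zigzagIndicator z e *
      ((D.zigzagCochain z').2 (D.white e) - (D.zigzagCochain z').2 e) =
      ∑ e, (D.zigzagIndicator z (D.white⁻¹ e) * D.zigzagIndicator z' e -
        D.zigzagIndicator z e * D.zigzagIndicator z' (D.white⁻¹ e)) := by
    have h3 := Equiv.sum_comp D.white⁻¹ fun e =>
      D.zigzagIndicator z e * D.zigzagIndicator z' (D.white e)
    have hww : ∀ e, D.white (D.white⁻¹ e) = e := fun e => D.white.apply_symm_apply e
    have hww' : ∀ e, D.white⁻¹ (D.white e) = e := fun e => D.white.symm_apply_apply e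
    simp only [hww] at h3
    rw [Finset.sum_sub_distrib, h3, ← Finset.sum_sub_distrib]
    refine Finset.sum_congr rfl fun e _ => ?_
    simp only [zigzagCochain, hww']
    ring
  rw [h2] at h1
  have h4 : ((wedge (D.winding z) (D.winding z') : ℤ) : ℚ) = ∑ e,
      (D.zigzagIndicator z (D.white⁻¹ e) * D.zigzagIndicator z' e -
        D.zigzagIndicator z e * D.zigzagIndicator z' (D.white⁻¹ e)) := by
    rw [wedge]
    push_cast
    linarith
  have h5 : (∑ e, ((if D.PosIntersection e z z' then 1 else 0) -
      if D.PosIntersection e z' z then 1 else 0 : ℤ) : ℚ) = ∑ e,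
      (D.zigzagIndicator z (D.white⁻¹ e) * D.zigzagIndicator z' e -
        D.zigzagIndicator z e * D.zigzagIndicator z' (D.white⁻¹ e)) := by
    refine Finset.sum_congr rfl fun e _ => ?_
    have hB : D.zigzagToWhite (D.white⁻¹ e) = D.zigzagToBlack e := rfl
    simp only [zigzagIndicator, hB, BipartiteMap.PosIntersection, eq_comm (a := z),
      eq_comm (a := z')]
    push_cast
    have hand : ∀ (p q : Prop) [Decidable p] [Decidable q] [Decidable (p ∧ q)],
        (if p ∧ q then 1 else 0 : ℚ) = (if p then 1 else 0) * (if q then 1 else 0) := by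
      intro p q _ _ _
      by_cases hp : p <;> by_cases hq : q <;> simp [hp, hq]
    rw [hand, hand, mul_comm (if D.zigzagToBlack e = z' then _ else _)]
  have h6 := h4.trans h5.symm
  exact_mod_cast h6

/-! ### Perfect matchings and crossing numbers -/

section Matching

theorem sum_whiteEnd {M : Finset E} (hM : D.IsPerfectMatching M) [Fintype D.White]
    (h : D.White → ℚ) : ∑ e ∈ M, h (D.whiteEnd e) = ∑ v, h v := by
  refine Finset.sum_bij (fun e _ => D.whiteEnd e) (fun _ _ => Finset.mem_univ _) ?_ ?_
    fun _ _ => rfl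
  · intro a ha b hb hab
    exact (hM.1 (D.whiteEnd b)).unique ⟨ha, hab⟩ ⟨hb, rfl⟩
  · intro v _
    obtain ⟨e, ⟨he, hv⟩, -⟩ := hM.1 v
    exact ⟨e, he, hv⟩

theorem sum_blackEnd {M : Finset E} (hM : D.IsPerfectMatching M) [Fintype D.Black]
    (h : D.Black → ℚ) : ∑ e ∈ M, h (D.blackEnd e) = ∑ v, h v := by
  refine Finset.sum_bij (fun e _ => D.blackEnd e) (fun _ _ => Finset.mem_univ _) ?_ ?_
    fun _ _ => rfl
  · intro a ha b hb hab
    exact (hM.2 (D.blackEnd b)).unique ⟨ha, hab⟩ ⟨hb, rfl⟩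
  · intro v _
    obtain ⟨e, ⟨he, hv⟩, -⟩ := hM.2 v
    exact ⟨e, he, hv⟩

/-- The number of crossings of a zigzag path with the closed path formed by two matchings. -/
theorem sum_zigzagCochain_sub {M M' : Finset E} (hM : D.IsPerfectMatching M)
    (hM' : D.IsPerfectMatching M') (z : D.Zigzag) :
    ∑ e ∈ M, (D.zigzagCochain z).2 e - ∑ e ∈ M', (D.zigzagCochain z).2 e =
      -((wedge (D.winding z) (∑ e ∈ M, D.step e - ∑ e ∈ M', D.step e) : ℤ) : ℚ) := by
  classical
  obtain ⟨P, Q, hP, hQ⟩ := D.exists_isPotential_step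
  obtain ⟨t, ht, ha, hb⟩ := exists_zigzagCochain_eq z _ _ hP hQ rfl rfl
  -- A matching meets every node once, so coboundaries of node functions contribute the same to all
  -- matchings.
  have h : ∀ N : Finset E, D.IsPerfectMatching N → ∑ e ∈ N, (D.zigzagCochain z).2 e =
      ∑ v, t.2.1 v + ∑ v, t.2.2.1 v + ((D.winding z).2 * ∑ e ∈ N, ((D.step e).1 : ℚ)
        - (D.winding z).1 * ∑ e ∈ N, ((D.step e).2 : ℚ)) := by
    intro N hN
    rw [← ht, ← sum_whiteEnd hN, ← sum_blackEnd hN]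
    simp only [closedSpan, LinearMap.coe_mk, AddHom.coe_mk, Prod.snd_add, Pi.add_apply,
      Prod.smul_snd, Pi.smul_apply, smul_eq_mul, ha, hb, Finset.sum_add_distrib, ← Finset.mul_sum]
    ring
  rw [h M hM, h M' hM', wedge]
  push_cast [Prod.fst_sub, Prod.snd_sub, Prod.fst_sum, Prod.snd_sum]
  ring

end Matching

end TorusDimer

/-! ### Consequences of proper ordering -/

theorem wedge_eq_zero_of_wedge_eq_zero {z u v : ℤ × ℤ} (hz : z ≠ 0) (hu : wedge z u = 0)
    (hv : wedge z v = 0) : wedge u v = 0 := by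
  simp only [wedge] at *
  by_contra h
  have h1 : z.1 * (u.1 * v.2 - u.2 * v.1) = 0 := by linear_combination u.1 * hv - v.1 * hu
  have h2 : z.2 * (u.1 * v.2 - u.2 * v.1) = 0 := by linear_combination u.2 * hv - v.2 * hu
  exact hz (Prod.ext ((mul_eq_zero.1 h1).resolve_right h) ((mul_eq_zero.1 h2).resolve_right h))

namespace BipartiteMap

variable {E : Type*} {D : BipartiteMap E} {M : Finset E}

theorem IsPerfectMatching.not_mem_white (hM : D.IsPerfectMatching M) {e : E}
    (he : D.white e ≠ e) (h : e ∈ M) : D.white e ∉ M := fun h' =>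
  he ((hM.1 (D.whiteEnd e)).unique
    ⟨h', Quotient.sound (Perm.sameCycle_apply_left.2 (Perm.SameCycle.refl _ _))⟩ ⟨h, rfl⟩)

theorem IsPerfectMatching.not_mem_black (hM : D.IsPerfectMatching M) {e : E}
    (he : D.black e ≠ e) (h : e ∈ M) : D.black e ∉ M := fun h' =>
  he ((hM.2 (D.blackEnd e)).unique
    ⟨h', Quotient.sound (Perm.sameCycle_apply_left.2 (Perm.SameCycle.refl _ _))⟩ ⟨h, rfl⟩)

end BipartiteMap

namespace TorusDimer

variable {E : Type*} [Fintype E] {D : TorusDimer E}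

namespace ProperlyOrdered

theorem zigzagToBlack_ne (hD : D.ProperlyOrdered) (e : E) :
    D.zigzagToBlack e ≠ D.zigzagToWhite e := fun h =>
  hD.not_sameRay e (by rw [h])

theorem white_ne (hD : D.ProperlyOrdered) (e : E) : D.white e ≠ e := fun h =>
  hD.zigzagToBlack_ne e (by conv_lhs => rw [← h, zigzagToBlack_white])

theorem black_ne (hD : D.ProperlyOrdered) (e : E) : D.black e ≠ e := fun h =>
  hD.zigzagToBlack_ne e (by rw [← zigzagToWhite_inv_black, Perm.inv_eq_iff_eq.2 h.symm])

/-- Three sectors at a node would need a positive wedge; a single one would make a zigzag path cross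
itself. -/
theorem minimalPeriod_eq_two {σ : Perm E} {e : E} (hσ : σ e ≠ e) (ho : D.OrderedAt σ e)
    (h : ∀ z z', wedge (D.winding z) (D.winding z') = 0) :
    Function.minimalPeriod σ e = 2 := by
  have h0 : 0 < Function.minimalPeriod σ e :=
    Function.minimalPeriod_pos_of_mem_periodicPts (σ.injective.mem_periodicPts _)
  have h1 : Function.minimalPeriod σ e ≠ 1 := fun h1 =>
    hσ (Function.minimalPeriod_eq_one_iff_isFixedPt.1 h1)
  by_contra h2
  have := ho 1 2 one_pos one_lt_two (by omega)
  simp [Counterclockwise, h] at this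

/-- Not all zigzag paths are parallel. -/
theorem exists_wedge_ne_zero (hD : D.ProperlyOrdered) (z : D.Zigzag) :
    ∃ z', wedge (D.winding z) (D.winding z') ≠ 0 := by
  classical
  by_contra! hz
  have h : ∀ u v, wedge (D.winding u) (D.winding v) = 0 := fun u v =>
    wedge_eq_zero_of_wedge_eq_zero (hD.winding_ne_zero z) (hz u) (hz v)
  have hw := sum_eq_sum_permCycles D.white fun _ => 1
  have hb := sum_eq_sum_permCycles D.black fun _ => 1
  simp only [fun e => minimalPeriod_eq_two (hD.white_ne e) (hD.white_ordered e) h,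
    Finset.sum_const, Finset.card_univ, Finset.card_range, smul_eq_mul, mul_one] at hw
  simp only [fun e => minimalPeriod_eq_two (hD.black_ne e) (hD.black_ordered e) h,
    Finset.sum_const, Finset.card_univ, Finset.card_range, smul_eq_mul, mul_one] at hb
  have he := D.euler
  simp only [Nat.card_eq_fintype_card] at he
  obtain ⟨e⟩ := D.nonempty_edge
  have hf : 0 < Fintype.card D.Face := Fintype.card_pos_iff.2 ⟨Quotient.mk _ e⟩
  change _ = Fintype.card D.White * 2 at hw
  change _ = Fintype.card D.Black * 2 at hb
  -- All nodes have degree two, so there are as many nodes as edges, and the Euler relation leaves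
  -- no faces.
  omega

end ProperlyOrdered

open Classical in
theorem winding_eq_sum (z : D.Zigzag) : D.winding z = ∑ e,
    ((if D.zigzagToBlack e = z then D.step e else 0) -
      if D.zigzagToWhite e = z then D.step e else 0) := by
  have h := Equiv.sum_comp D.white fun e => if D.zigzagToBlack e = z then D.step e else 0
  simp only [zigzagToBlack_white] at h
  rw [Finset.sum_sub_distrib, ← h, ← Finset.sum_sub_distrib, winding, Finset.sum_filter]
  refine Finset.sum_congr rfl fun e _ => ?_
  split_ifs <;> simp

theorem point_eq (M : Finset E) :
    D.point M = (-(∑ e ∈ M, D.step e).2, (∑ e ∈ M, D.step e).1) := by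
  simp [point, exponent, Prod.ext_iff, Prod.fst_sum, Prod.snd_sum]

/-! ### Boundary matchings along their zigzag paths -/

namespace IsBoundaryBasis

variable {n : ℕ} {Z : Fin n ≃ D.Zigzag} {M : Fin n → Finset E}

/-- Both `e` and `white e` lie in exactly one of the two matchings, and neither matching contains
both edges since they meet at a white node; hence they alternate. -/
theorem mem_iff_white_not_mem (hM : D.IsBoundaryBasis Z M) (hD : D.ProperlyOrdered) {i : Fin n}
    {e : E} (he : D.zigzagToWhite e = Z i) :
    (e ∈ M i ↔ D.white e ∉ M i) ∧ (e ∈ M (finRotate n i) ↔ e ∉ M i) ∧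
      (D.white e ∈ M (finRotate n i) ↔ e ∈ M i) := by
  have h1 := (hM.diff i e).2 (Or.inl he)
  have h2 := (hM.diff i (D.white e)).2 (Or.inr (by rw [zigzagToBlack_white, he]))
  have h3 := (hM.perfect i).not_mem_white (hD.white_ne e)
  have h4 := (hM.perfect (finRotate n i)).not_mem_white (hD.white_ne e)
  simp only [Xor] at h1 h2
  tauto

theorem zigzagPerm_mem_iff (hM : D.IsBoundaryBasis Z M) (hD : D.ProperlyOrdered) {i : Fin n}
    {e : E} (he : D.zigzagToWhite e = Z i) : D.zigzagPerm e ∈ M i ↔ e ∈ M i := by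
  have h0 := hM.mem_iff_white_not_mem hD he
  obtain ⟨f, hf⟩ : ∃ f, f = D.zigzagPerm e := ⟨_, rfl⟩
  have hb : D.black f = D.white e := by
    rw [hf]
    exact D.black.apply_symm_apply _
  have hw : D.zigzagToWhite f = Z i := by
    rw [← he, hf]
    exact Quotient.sound (Perm.sameCycle_apply_left.2 (Perm.SameCycle.refl _ _))
  have h1 := (hM.diff i f).2 (Or.inl hw)
  have h3 := (hM.perfect i).not_mem_black (hD.black_ne f)
  have h4 := (hM.perfect (finRotate n i)).not_mem_black (hD.black_ne f)
  rw [hb] at h3 h4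
  rw [← hf]
  simp only [Xor] at h1
  tauto

theorem mem_iff_mem (hM : D.IsBoundaryBasis Z M) (hD : D.ProperlyOrdered) {i : Fin n}
    {e f : E} (he : D.zigzagToWhite e = Z i) (hf : D.zigzagToWhite f = Z i) :
    e ∈ M i ↔ f ∈ M i := by
  have hs : D.zigzagPerm.SameCycle e f :=
    Quotient.exact (s := Perm.SameCycle.setoid D.zigzagPerm) (he.trans hf.symm)
  have h := Perm.SameCycle.apply_eq_of_invariant
    (f := fun e => D.zigzagToWhite e = Z i ∧ e ∈ M i) (fun e => by
      have hw : D.zigzagToWhite (D.zigzagPerm e) = D.zigzagToWhite e :=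
        Quotient.sound (Perm.sameCycle_apply_left.2 (Perm.SameCycle.refl _ _))
      rw [hw]
      exact propext (and_congr_right fun h => hM.zigzagPerm_mem_iff hD h)) hs
  simpa [he, hf] using h

theorem not_memZigzag_iff (hM : D.IsBoundaryBasis Z M) {i : Fin n} {e : E}
    (he : ¬ D.MemZigzag e (Z i)) : e ∈ M (finRotate n i) ↔ e ∈ M i := by
  rw [← hM.diff i e, xor_iff_not_iff, not_not] at he
  exact he.symm

/-- The matchings agree off `Z i`, and on it their difference is the path itself, run forwards if `M
i` has the edges left towards white and backwards otherwise. -/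
theorem sum_step_sub (hM : D.IsBoundaryBasis Z M) (hD : D.ProperlyOrdered) (i : Fin n) :
    ∃ ε : ℤ, (ε = 1 ∧ ∀ e, D.zigzagToWhite e = Z i → e ∈ M i) ∧
      ∑ e ∈ M (finRotate n i), D.step e - ∑ e ∈ M i, D.step e = ε • D.winding (Z i) ∨
      (ε = -1 ∧ ∀ e, D.zigzagToWhite e = Z i → e ∉ M i) ∧
      ∑ e ∈ M (finRotate n i), D.step e - ∑ e ∈ M i, D.step e = ε • D.winding (Z i) := by
  classical
  have hcase : (∀ e, D.zigzagToWhite e = Z i → e ∈ M i) ∨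
      ∀ e, D.zigzagToWhite e = Z i → e ∉ M i := by
    by_cases h : ∃ e, D.zigzagToWhite e = Z i ∧ e ∈ M i
    · obtain ⟨f, hf, hfm⟩ := h
      exact Or.inl fun e he => (hM.mem_iff_mem hD he hf).2 hfm
    · push Not at h
      exact Or.inr h
  have hsum : ∑ e ∈ M (finRotate n i), D.step e - ∑ e ∈ M i, D.step e = ∑ e,
      ((if e ∈ M (finRotate n i) then D.step e else 0) - if e ∈ M i then D.step e else 0) := by
    simp [Finset.sum_sub_distrib]
  have hblack : ∀ e, D.zigzagToBlack e = Z i →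
      (e ∈ M i ↔ D.white⁻¹ e ∉ M i) ∧ (e ∈ M (finRotate n i) ↔ D.white⁻¹ e ∈ M i) := fun e he => by
    have h1 := hM.mem_iff_white_not_mem hD (e := D.white⁻¹ e) he
    have h2 : D.white (D.white⁻¹ e) = e := D.white.apply_symm_apply e
    rw [h2] at h1
    tauto
  rcases hcase with h | h
  · refine ⟨1, Or.inl ⟨⟨rfl, h⟩, ?_⟩⟩
    rw [hsum, winding_eq_sum, one_smul]
    refine Finset.sum_congr rfl fun e _ => ?_
    by_cases hw : D.zigzagToWhite e = Z i
    · have hb : ¬ D.zigzagToBlack e = Z i := fun hb => hD.zigzagToBlack_ne e (hb.trans hw.symm)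
      simp [-finRotate_apply, hw, hb, (hM.mem_iff_white_not_mem hD hw).2.1, h e hw]
    · by_cases hb : D.zigzagToBlack e = Z i
      · simp [-finRotate_apply, hw, hb, hblack e hb, h (D.white⁻¹ e) hb, -Perm.coe_inv]
      · simp [-finRotate_apply, hw, hb, hM.not_memZigzag_iff (not_or.2 ⟨hw, hb⟩)]
  · refine ⟨-1, Or.inr ⟨⟨rfl, h⟩, ?_⟩⟩
    rw [hsum, winding_eq_sum, neg_one_smul, ← Finset.sum_neg_distrib]
    refine Finset.sum_congr rfl fun e _ => ?_
    by_cases hw : D.zigzagToWhite e = Z i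
    · have hb : ¬ D.zigzagToBlack e = Z i := fun hb => hD.zigzagToBlack_ne e (hb.trans hw.symm)
      simp [-finRotate_apply, hw, hb, (hM.mem_iff_white_not_mem hD hw).2.1, h e hw]
    · by_cases hb : D.zigzagToBlack e = Z i
      · simp [-finRotate_apply, hw, hb, hblack e hb, h (D.white⁻¹ e) hb, -Perm.coe_inv]
      · simp [-finRotate_apply, hw, hb, hM.not_memZigzag_iff (not_or.2 ⟨hw, hb⟩)]

/-- Points are step sums turned by a quarter turn, which preserves wedges, so this is convexity of
the diagram. -/
theorem wedge_step_nonneg (hM : D.IsBoundaryBasis Z M) (i j : Fin n) :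
    0 ≤ wedge (∑ e ∈ M (finRotate n i), D.step e - ∑ e ∈ M i, D.step e)
      (∑ e ∈ M j, D.step e - ∑ e ∈ M i, D.step e) := by
  have h := (hM.next i).2.2.1 _ (hM.next j).1
  simp only [point_eq, wedge] at h
  simp only [wedge, Prod.fst_sub, Prod.snd_sub]
  have h' : (0 : ℝ) ≤ (((∑ e ∈ M (finRotate n i), D.step e).1 - (∑ e ∈ M i, D.step e).1) *
      ((∑ e ∈ M j, D.step e).2 - (∑ e ∈ M i, D.step e).2) -
      ((∑ e ∈ M (finRotate n i), D.step e).2 - (∑ e ∈ M i, D.step e).2) *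
      ((∑ e ∈ M j, D.step e).1 - (∑ e ∈ M i, D.step e).1) : ℤ) := by
    push_cast at h ⊢
    linarith
  exact_mod_cast h'

theorem sum_zigzagCochain_eq [DecidableEq E] (z : D.Zigzag) (N : Finset E) :
    ∑ e ∈ N, (D.zigzagCochain z).2 e = ∑ e, D.zigzagIndicator z e *
      ((if e ∈ N then 1 else 0) + if D.white e ∈ N then 1 else 0) := by
  have h := Equiv.sum_comp D.white fun e => if e ∈ N then D.zigzagIndicator z (D.white⁻¹ e) else 0
  have hww : ∀ e, D.white⁻¹ (D.white e) = e := fun e => D.white.symm_apply_apply e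
  simp only [hww] at h
  simp only [zigzagCochain, mul_add, Finset.sum_add_distrib, mul_ite, mul_one, mul_zero, h]
  simp

/-- A boundary matching has the most edges on the zigzag path that follows it. -/
theorem sum_zigzagCochain_le (hM : D.IsBoundaryBasis Z M) (hD : D.ProperlyOrdered) (i j : Fin n) :
    ∑ e ∈ M j, (D.zigzagCochain (Z i)).2 e ≤ ∑ e ∈ M i, (D.zigzagCochain (Z i)).2 e := by
  classical
  rw [sum_zigzagCochain_eq, sum_zigzagCochain_eq]
  refine Finset.sum_le_sum fun e _ => ?_
  by_cases he : D.zigzagToWhite e = Z i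
  -- Of each pair `e`, `white e` on `Z i`, the matching `M i` has exactly one edge and `M j` at most
  -- one.
  · have h1 := (hM.mem_iff_white_not_mem hD he).1
    have h2 := (hM.perfect j).not_mem_white (hD.white_ne e)
    by_cases h3 : e ∈ M i <;> by_cases h4 : e ∈ M j <;> by_cases h5 : D.white e ∈ M i <;>
      by_cases h6 : D.white e ∈ M j <;> simp_all [zigzagIndicator]
  · simp [zigzagIndicator, he]

/-- The matching `M i` contains the edges that the zigzag path `Z i` leaves towards white. -/
theorem mem_of_zigzagToWhite (hM : D.IsBoundaryBasis Z M) (hD : D.ProperlyOrdered) {i : Fin n}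
    {e : E} (he : D.zigzagToWhite e = Z i) : e ∈ M i := by
  obtain ⟨ε, ⟨⟨-, h⟩, -⟩ | ⟨⟨rfl, h⟩, hi⟩⟩ := hM.sum_step_sub hD i
  · exact h e he
  exfalso
  -- With the wrong sign, convexity and maximality bound this wedge from opposite sides.
  have hzero : ∀ j, wedge (D.winding (Z i)) (∑ e ∈ M j, D.step e - ∑ e ∈ M i, D.step e) = 0 := by
    intro j
    have h1 := hM.wedge_step_nonneg i j
    have h2 := hM.sum_zigzagCochain_le hD i j
    have h3 := sum_zigzagCochain_sub (hM.perfect j) (hM.perfect i) (Z i)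
    rw [hi] at h1
    have h4 : (0 : ℚ) ≤ (wedge (D.winding (Z i))
        (∑ e ∈ M j, D.step e - ∑ e ∈ M i, D.step e) : ℤ) := by linarith
    have h5 : 0 ≤ wedge (D.winding (Z i))
        (∑ e ∈ M j, D.step e - ∑ e ∈ M i, D.step e) := by exact_mod_cast h4
    simp only [wedge, neg_smul, one_smul, Prod.fst_neg, Prod.snd_neg] at h1 h5 ⊢
    linarith
  obtain ⟨z', hz'⟩ := hD.exists_wedge_ne_zero (Z i)
  obtain ⟨j, rfl⟩ := Z.surjective z'
  refine hz' ?_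
  have h1 := hzero j
  have h2 := hzero (finRotate n j)
  have h3 : wedge (D.winding (Z i))
      (∑ e ∈ M (finRotate n j), D.step e - ∑ e ∈ M j, D.step e) = 0 := by
    simp only [wedge, Prod.fst_sub, Prod.snd_sub] at h1 h2 ⊢
    linarith
  obtain ⟨ε, ⟨⟨rfl, -⟩, hj⟩ | ⟨⟨rfl, -⟩, hj⟩⟩ := hM.sum_step_sub hD j
  · rwa [hj, one_smul] at h3
  · rw [hj] at h3
    simp only [wedge, neg_smul, one_smul, Prod.fst_neg, Prod.snd_neg] at h3 ⊢
    linarith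

end IsBoundaryBasis

end TorusDimer

/-! ### Cyclic stretches and antisymmetric sums -/

theorem finRotate_val_of_lt {n : ℕ} {i : Fin n} (h : (i : ℕ) + 1 < n) :
    (finRotate n i : ℕ) = i + 1 := by
  obtain ⟨m, rfl⟩ : ∃ m, n = m + 1 := ⟨n - 1, by omega⟩
  rw [coe_finRotate_of_ne_last]
  intro hl
  rw [hl] at h
  simp at h

theorem cc_compl {n : ℕ} {r s : Fin n} (h : r ≠ s) : (cc r s)ᶜ = cc s r := by
  ext i
  have h' : (r : ℕ) ≠ s := fun hv => h (Fin.ext hv)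
  simp only [cc, Finset.mem_compl, Finset.mem_filter, Finset.mem_univ, true_and, Fin.lt_def,
    Fin.le_def]
  omega

/-- A proposition that becomes true after `r`, becomes false after `s`, and does not change
elsewhere, holds on the stretch from `r` to `s`. -/
theorem iff_mem_cc {n : ℕ} {r s : Fin n} (hrs : r ≠ s) {p : Fin n → Prop}
    (hr : ¬ p r) (hr' : p (finRotate n r)) (hs : p s) (hs' : ¬ p (finRotate n s))
    (hp : ∀ i, i ≠ r → i ≠ s → (p (finRotate n i) ↔ p i)) (i : Fin n) : p i ↔ i ∈ cc r s := by
  -- The claimed equivalence is equally true or false at all indices, by comparison with index `0`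
  -- without wrapping around; it is then checked at `s`.
  have hstep : ∀ k : ℕ, ∀ hk : k < n, ∀ h0 : 0 < n,
      ((p ⟨k, hk⟩ ↔ (⟨k, hk⟩ : Fin n) ∈ cc r s) ↔ (p ⟨0, h0⟩ ↔ (⟨0, h0⟩ : Fin n) ∈ cc r s)) := by
    intro k
    induction k with
    | zero => exact fun _ _ => Iff.rfl
    | succ k ih =>
      intro hk h0
      rw [← ih (by omega) h0]
      have hrot : finRotate n ⟨k, by omega⟩ = ⟨k + 1, hk⟩ := Fin.ext (finRotate_val_of_lt hk)
      have hrsv : (r : ℕ) ≠ s := fun hv => hrs (Fin.ext hv)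
      rw [← hrot]
      by_cases h1 : (⟨k, by omega⟩ : Fin n) = r
      · have hc : (⟨k, by omega⟩ : Fin n) ∉ cc r s ∧ finRotate n ⟨k, by omega⟩ ∈ cc r s := by
          rw [hrot]
          have hv := congrArg Fin.val h1
          simp only at hv
          simp only [cc, Finset.mem_filter, Finset.mem_univ, true_and, Fin.lt_def, Fin.le_def]
          omega
        rw [h1] at hc ⊢
        tauto
      by_cases h2 : (⟨k, by omega⟩ : Fin n) = s
      · have hc : (⟨k, by omega⟩ : Fin n) ∈ cc r s ∧ finRotate n ⟨k, by omega⟩ ∉ cc r s := by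
          rw [hrot]
          have hv := congrArg Fin.val h2
          simp only at hv
          simp only [cc, Finset.mem_filter, Finset.mem_univ, true_and, Fin.lt_def, Fin.le_def]
          omega
        rw [h2] at hc ⊢
        tauto
      · have hc : (⟨k, by omega⟩ : Fin n) ∈ cc r s ↔ finRotate n ⟨k, by omega⟩ ∈ cc r s := by
          rw [hrot]
          have hv1 : k ≠ r := fun hv => h1 (Fin.ext hv)
          have hv2 : k ≠ s := fun hv => h2 (Fin.ext hv)
          simp only [cc, Finset.mem_filter, Finset.mem_univ, true_and, Fin.lt_def, Fin.le_def]
          omega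
        rw [hp _ h1 h2, ← hc]
  have h0 : 0 < n := i.pos
  have hmem : s ∈ cc r s := by
    have hrsv : (r : ℕ) ≠ s := fun hv => hrs (Fin.ext hv)
    simp only [cc, Finset.mem_filter, Finset.mem_univ, true_and, Fin.lt_def, Fin.le_def]
    omega
  exact (hstep i i.isLt h0).2 ((hstep s s.isLt h0).1 (iff_of_true hs hmem))

/-- Double counting of pairs with an antisymmetric weight. -/
theorem sum_antisymm_eq {E : Type*} [Fintype E] {n : ℕ} (a b : E → Fin n)
    (hab : ∀ e, a e ≠ b e) (f : Fin n → Fin n → ℝ) (hf : ∀ r s, r ≠ s → f s r = -f r s) :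
    ∑ e, f (a e) (b e) = ∑ r, ∑ s ∈ Finset.Ioi r,
      (∑ e, ((if a e = r ∧ b e = s then 1 else 0) - if a e = s ∧ b e = r then 1 else 0)) *
        f r s := by
  have h : ∀ e, f (a e) (b e) = ∑ r, ∑ s ∈ Finset.Ioi r,
      ((if a e = r ∧ b e = s then 1 else 0) - if a e = s ∧ b e = r then 1 else 0) * f r s := by
    intro e
    have h1 : ∀ r, ∀ s ∈ Finset.Ioi r,
        ((if a e = r ∧ b e = s then 1 else 0) - if a e = s ∧ b e = r then 1 else 0) * f r s =
        (if a e = s ∧ b e = r then f s r else 0) + if a e = r ∧ b e = s then f r s else 0 := by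
      intro r s hs
      rw [hf r s (Finset.mem_Ioi.1 hs).ne]
      split_ifs <;> ring
    rw [Finset.sum_congr rfl fun r _ => Finset.sum_congr rfl (h1 r),
      Finset.sum_sum_Ioi_add_eq_sum_sum_off_diag
        (fun r s => if a e = r ∧ b e = s then f r s else 0)]
    rw [Finset.sum_eq_single (b e), Finset.sum_eq_single (a e)]
    · simp
    · intro s _ hs
      rw [if_neg (fun h => hs h.1.symm)]
    · intro h
      simp [hab e] at h
    · intro r _ hr
      exact Finset.sum_eq_zero fun s _ => if_neg fun h => hr h.2.symm
    · simp
  rw [Finset.sum_congr rfl fun e _ => h e, Finset.sum_comm]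
  refine Finset.sum_congr rfl fun r _ => ?_
  rw [Finset.sum_comm]
  exact Finset.sum_congr rfl fun s _ => (Finset.sum_mul _ _ _).symm

/-! ### Membership of crossings and the anomaly formula -/

namespace TorusDimer

variable {E : Type*} [Fintype E] {D : TorusDimer E}

namespace IsBoundaryBasis

variable {n : ℕ} {Z : Fin n ≃ D.Zigzag} {M : Fin n → Finset E}

theorem mem_iff_of_posIntersection (hM : D.IsBoundaryBasis Z M) (hD : D.ProperlyOrdered)
    {r s : Fin n} {e : E} (he : D.PosIntersection e (Z r) (Z s)) (i : Fin n) :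
    e ∈ M i ↔ i ∈ cc r s := by
  obtain ⟨hr, hs⟩ := he
  have hrs : r ≠ s := by
    rintro rfl
    exact hD.zigzagToBlack_ne e (hr.symm.trans hs)
  have h1 := hM.mem_of_zigzagToWhite hD hs.symm
  have h2 := hM.mem_iff_white_not_mem hD hs.symm
  have hr' : D.zigzagToWhite (D.white⁻¹ e) = Z r := hr.symm
  have h3 := hM.mem_of_zigzagToWhite hD hr'
  have h4 := hM.mem_iff_white_not_mem hD hr'
  have hww : D.white (D.white⁻¹ e) = e := D.white.apply_symm_apply e
  rw [hww] at h4
  refine iff_mem_cc (p := fun i => e ∈ M i) hrs (h4.1.1 h3) (h4.2.2.2 h3) h1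
    (fun h => h2.2.1.1 h h1) (fun j hjr hjs => hM.not_memZigzag_iff ?_) i
  rintro (h | h)
  · exact hjs (Z.injective (h.symm.trans hs.symm))
  · exact hjr (Z.injective (h.symm.trans hr.symm))

/-- Each `matchingDelta (M i)` sums to `2` at every node, so one node condition suffices. -/
theorem sum_eq_one [DecidableEq E] (hM : D.IsBoundaryBasis Z M) {R : E → ℝ} {lam : Fin n → ℝ}
    (hR : D.NodeCondition R) (hlam : ∀ e, R e = ∑ i, lam i * matchingDelta (M i) e) :
    ∑ i, lam i = 1 := by
  classical
  obtain ⟨e₀⟩ := D.nonempty_edge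
  have h1 := hR.1 (D.whiteEnd e₀)
  simp only [hlam] at h1
  rw [Finset.sum_comm] at h1
  have h2 : ∀ i, ∑ e : E with D.whiteEnd e = D.whiteEnd e₀, lam i * matchingDelta (M i) e =
      lam i * 2 := by
    intro i
    obtain ⟨e, ⟨he, hv⟩, hu⟩ := (hM.perfect i).1 (D.whiteEnd e₀)
    rw [← Finset.mul_sum, Finset.sum_eq_single e]
    · simp [matchingDelta, he]
    · intro f hf hne
      rw [Finset.mem_filter] at hf
      exact if_neg fun hfm => hne (hu f ⟨hfm, hf.2⟩)
    · intro hn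
      simp [hv] at hn
  have h3 : (∑ i, lam i) * 2 = 2 := by
    rw [Finset.sum_mul, ← Finset.sum_congr rfl fun i _ => h2 i]
    convert h1
  linarith

theorem anomaly_eq [DecidableEq E] (hM : D.IsBoundaryBasis Z M) (hD : D.ProperlyOrdered) (N : ℕ)
    {R : E → ℝ} {lam : Fin n → ℝ} (hR : D.NodeCondition R)
    (hlam : ∀ e, R e = ∑ i, lam i * matchingDelta (M i) e) :
    D.anomaly N R = 9 * (N : ℝ) ^ 2 / 32 * ((Nat.card D.Face : ℝ) +
      ∑ r : Fin n, ∑ s ∈ Finset.Ioi r,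
        ((wedge (D.winding (Z r)) (D.winding (Z s)) : ℤ) : ℝ) *
          (2 * (∑ i ∈ cc r s, lam i) - 1) ^ 3) := by
  classical
  have hsum := hM.sum_eq_one hR hlam
  set a : E → Fin n := fun e => Z.symm (D.zigzagToBlack e) with ha
  set b : E → Fin n := fun e => Z.symm (D.zigzagToWhite e) with hb
  have hpos : ∀ e r s, D.PosIntersection e (Z r) (Z s) ↔ a e = r ∧ b e = s := fun e r s => by
    simp only [ha, hb, Equiv.symm_apply_eq, BipartiteMap.PosIntersection, eq_comm (a := Z _)]
  have hab : ∀ e, a e ≠ b e := fun e h => hD.zigzagToBlack_ne e (Z.symm.injective h)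
  have hRe : ∀ e, (R e - 1) ^ 3 = (2 * (∑ i ∈ cc (a e) (b e), lam i) - 1) ^ 3 := fun e => by
    have h := hM.mem_iff_of_posIntersection hD ((hpos e _ _).2 ⟨rfl, rfl⟩)
    have h2 : R e = 2 * ∑ i ∈ cc (a e) (b e), lam i := by
      rw [hlam, Finset.mul_sum, ← Finset.sum_subset (Finset.subset_univ (cc (a e) (b e)))]
      · exact Finset.sum_congr rfl fun i hi => by
          rw [matchingDelta, if_pos ((h i).2 hi), mul_comm]
      · intro i _ hi
        rw [matchingDelta, if_neg (fun hm => hi ((h i).1 hm)), mul_zero]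
    rw [h2]
  -- As the coefficients add up to `1`, passing to the complementary stretch changes the sign of the
  -- odd power; hence only signed crossing numbers matter.
  have hanti : ∀ r s : Fin n, r ≠ s → (2 * (∑ i ∈ cc s r, lam i) - 1) ^ 3 =
      -(2 * (∑ i ∈ cc r s, lam i) - 1) ^ 3 := fun r s hrs => by
    have h := Finset.sum_add_sum_compl (cc r s) lam
    rw [cc_compl hrs, hsum] at h
    rw [← eq_sub_iff_add_eq'] at h
    rw [h]
    ring
  rw [anomaly, Finset.sum_congr rfl fun e _ => hRe e,
    sum_antisymm_eq a b hab (fun r s => (2 * (∑ i ∈ cc r s, lam i) - 1) ^ 3) hanti]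
  congr 2
  refine Finset.sum_congr rfl fun r _ => Finset.sum_congr rfl fun s _ => ?_
  rw [wedge_winding]
  push_cast
  simp only [hpos]

end IsBoundaryBasis

end TorusDimer

theorem mainTheorem8 {E : Type*} [Fintype E] [DecidableEq E] (D : TorusDimer E)
    (hD : D.ProperlyOrdered) {n : ℕ} (Z : Fin n ≃ D.Zigzag) (M : Fin n → Finset E)
    (hM : D.IsBoundaryBasis Z M) :
    (∀ (r s : Fin n) (e : E), D.PosIntersection e (Z r) (Z s) →
      ∀ i, e ∈ M i ↔ i ∈ cc r s) ∧
    (∀ (r s : Fin n) (e : E), D.NegIntersection e (Z r) (Z s) →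
      ∀ i, e ∈ M i ↔ i ∈ cc s r) ∧
    (∀ (N : ℕ) (R : E → ℝ) (lam : Fin n → ℝ), D.NodeCondition R →
      (∀ e, R e = ∑ i, lam i * matchingDelta (M i) e) →
      D.anomaly N R = 9 * (N : ℝ) ^ 2 / 32 * ((Nat.card D.Face : ℝ) +
        ∑ r : Fin n, ∑ s ∈ Finset.Ioi r,
          ((wedge (D.winding (Z r)) (D.winding (Z s)) : ℤ) : ℝ) *
            (2 * (∑ i ∈ cc r s, lam i) - 1) ^ 3)) := by
  refine ⟨fun r s e he i => hM.mem_iff_of_posIntersection hD he i,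
    fun r s e he i => hM.mem_iff_of_posIntersection hD ⟨he.2, he.1⟩ i,
    fun N R lam hR hlam => hM.anomaly_eq hD N hR hlam⟩
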